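/- Let $(X,\mu)$ and $(Y,\nu)$ be $\sigma$-finite standard measure spaces, i.e. $\mu$ and $\nu$ are $\sigma$-finite regular Borel measures with respect to complete metrisable topologies on $X$ and $Y$. Put $H_1=L^2(X,\mu)$, $H_2=L^2(Y,\nu)$ (complex scalars). A set $E\subseteq X\times Y$ is marginally null if $E\subseteq (X_0\times Y)\cup(X\times Y_0)$ with $\mu(X_0)=\nu(Y_0)=0$; two sets are marginally equivalent ($\simeq$) if their symmetric difference is marginally null. A set is $\omega$-open if it is marginally equivalent to a countable union of measurable rectangles, and $\omega$-closed if its complement is $\omega$-open. For measurable $\gamma$ let $P(\gamma)$ be multiplication by $\chi_\gamma$ on $L^2$. An $\omega$-closed set $\kappa$ supports a bounded operator $T:H_1\to H_2$ if $P(b)TP(a)=0$ for all measurable $a\subseteq X$, $b\subseteq Y$ with $(a\times b)\cap\kappa\simeq\emptyset$; $\mathfrak M_{\max}(\kappa)$ denotes the space of all bounded operators $H_1\to H_2$ supported on $\kappa$ (the largest weak* closed masa-bimodule with support $\kappa$). The $\omega$-closed set $\kappa$ is an operator $U$-set if $\mathfrak M_{\max}(\kappa)$ contains no non-zero compact operator.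 For $k\in L^2(Y\times X)$ let $T_k\xi(y)=\int_X k(y,x)\xi(x)\,d\mu(x)$. A measurable function $\varphi:X\times Y\to\mathbb C$ is a Schur multiplier if, with $\hat\varphi(y,x)=\varphi(x,y)$, the map $T_k\mapsto T_{\hat\varphi k}$, defined for those $k\in L^2(Y\times X)$ with $\hat\varphi k\in L^2(Y\times X)$, is bounded in the operator norm. A pair $(\kappa_1,\kappa_2)$ of $\omega$-closed sets is m-separable if there are a Schur multiplier $\varphi$ and $\omega$-open sets $E_1\supseteq\kappa_1$, $E_2\supseteq\kappa_2$ such that $\varphi=1$ on $E_1$ and $\varphi=0$ on $E_2$, up to marginally null sets. Let $\kappa\subseteq X\times Y$ be $\omega$-closed and let $\alpha\ge 1$ be a countable ordinal. A family $(\kappa_\beta)_{1\le\beta\le\alpha}$ of $\omega$-closed sets is an m-resolution of $\kappa$ if $\kappa_1=\kappa$; for every $1\le\beta<\alpha$ one has $\kappa_{\beta+1}\subseteq\kappa_\beta$, the set $\kappa_\beta\setminus\kappa_{\beta+1}$ is $\omega$-closed and the pair $(\kappa_{\beta+1},\kappa_\beta\setminus\kappa_{\beta+1})$ is m-separable; and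 $\kappa_\beta=\bigcap_{1\le\gamma<\beta}\kappa_\gamma$ for every limit ordinal $\beta\le\alpha$. **Theorem.** Suppose that the $\omega$-closed set $\kappa$ possesses an m-resolution $(\kappa_\beta)_{1\le\beta\le\alpha}$ such that $\kappa_\beta\setminus\kappa_{\beta+1}$ is an operator $U$-set for every $1\le\beta<\alpha$ and $\kappa_\alpha$ is an operator $U$-set. Then $\kappa$ is an operator $U$-set. -/

import Mathlib

open MeasureTheory Filter
open scoped ENNReal

noncomputable section

/-! ### Marginal equivalence, `ω`-open and `ω`-closed sets

`X × Y` carries the product `σ`-algebra, i.e. the one generated by the measurable rectangles. -/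

section Sets

variable {X Y : Type*} [MeasurableSpace X] [MeasurableSpace Y]

/-- `E ⊆ (X₀ × Y) ∪ (X × Y₀)` for some `X₀`, `Y₀` with `μ X₀ = 0`, `ν Y₀ = 0`. -/
def MarginallyNull (μ : Measure X) (ν : Measure Y) (E : Set (X × Y)) : Prop :=
  ∃ (X₀ : Set X) (Y₀ : Set Y), μ X₀ = 0 ∧ ν Y₀ = 0 ∧ E ⊆ {p | p.1 ∈ X₀ ∨ p.2 ∈ Y₀}

/-- `E` and `F` are marginally equivalent: their symmetric difference is marginally null. -/
def MarginallyEquiv (μ : Measure X) (ν : Measure Y) (E F : Set (X × Y)) : Prop :=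
  MarginallyNull μ ν (symmDiff E F)

/-- `E` is marginally equivalent to the union of a countable family of measurable rectangles. -/
def IsOmegaOpen (μ : Measure X) (ν : Measure Y) (E : Set (X × Y)) : Prop :=
  ∃ (a : ℕ → Set X) (b : ℕ → Set Y), (∀ n, MeasurableSet (a n)) ∧ (∀ n, MeasurableSet (b n)) ∧
    MarginallyEquiv μ ν E (⋃ n, a n ×ˢ b n)

/-- The complement of `E` is `ω`-open. -/
def IsOmegaClosed (μ : Measure X) (ν : Measure Y) (E : Set (X × Y)) : Prop :=
  IsOmegaOpen μ ν Eᶜ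

end Sets

/-! ### Multiplication operators and supports of operators -/

section Operators

variable {X Y : Type*} [MeasurableSpace X] [MeasurableSpace Y]

/-- The operator `M_f` of multiplication by `f ∈ L^∞(X, μ)` on `L²(X, μ)`. -/
def mulOp {μ : Measure X} (f : Lp ℂ ∞ μ) : Lp ℂ 2 μ →L[ℂ] Lp ℂ 2 μ :=
  (ContinuousLinearMap.mul ℂ ℂ).holderL μ ∞ 2 2 f

lemma mulOp_ae {μ : Measure X} (f : Lp ℂ ∞ μ) (ξ : Lp ℂ 2 μ) :
    mulOp f ξ =ᵐ[μ] fun x => f x * ξ x :=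
  (ContinuousLinearMap.mul ℂ ℂ).coeFn_holder f ξ

lemma memLp_top_indicator_one (μ : Measure X) {a : Set X} (ha : MeasurableSet a) :
    MemLp (a.indicator fun _ => (1 : ℂ)) ∞ μ :=
  (memLp_top_const (1 : ℂ)).indicator ha

/-- The projection `P(a) = M_{χ_a}`, for a measurable set `a ⊆ X`. -/
def projOp (μ : Measure X) {a : Set X} (ha : MeasurableSet a) : Lp ℂ 2 μ →L[ℂ] Lp ℂ 2 μ :=
  mulOp (memLp_top_indicator_one μ ha).toLp

lemma mulOp_comm {μ : Measure X} (f g : Lp ℂ ∞ μ) : mulOp f ∘L mulOp g = mulOp g ∘L mulOp f := by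
  ext1 ξ
  apply Lp.ext
  filter_upwards [mulOp_ae f (mulOp g ξ), mulOp_ae g ξ, mulOp_ae g (mulOp f ξ), mulOp_ae f ξ]
    with x h1 h2 h3 h4
  simp only [ContinuousLinearMap.comp_apply, h1, h2, h3, h4]
  ring

/-- `κ` supports the operator `T : L²(X, μ) → L²(Y, ν)`: `P(b) T P(a) = 0` for every measurable
rectangle `a × b` with `(a × b) ∩ κ` marginally equivalent to `∅`. -/
def Supports (μ : Measure X) (ν : Measure Y) (κ : Set (X × Y))
    (T : Lp ℂ 2 μ →L[ℂ] Lp ℂ 2 ν) : Prop :=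
  ∀ (a : Set X) (b : Set Y) (ha : MeasurableSet a) (hb : MeasurableSet b),
    MarginallyEquiv μ ν ((a ×ˢ b) ∩ κ) ∅ → projOp ν hb ∘L T ∘L projOp μ ha = 0

/-- The subspace `W` is invariant under multiplication by `L^∞` functions on both sides. -/
def IsMasaBimodule {μ : Measure X} {ν : Measure Y}
    (W : Submodule ℂ (Lp ℂ 2 μ →L[ℂ] Lp ℂ 2 ν)) : Prop :=
  ∀ T ∈ W, ∀ (f : Lp ℂ ∞ μ) (g : Lp ℂ ∞ ν), mulOp g ∘L T ∘L mulOp f ∈ W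

/-- `𝔐_max(κ)`, for `κ` an `ω`-closed set: the space of all operators supported on `κ`. It is the
largest (weak* closed) masa-bimodule all of whose elements are supported on `κ`. -/
def maxBimodule (μ : Measure X) (ν : Measure Y) (κ : Set (X × Y)) :
    Submodule ℂ (Lp ℂ 2 μ →L[ℂ] Lp ℂ 2 ν) where
  carrier := {T | Supports μ ν κ T}
  zero_mem' := by
    intro a b ha hb _
    simp
  add_mem' := by
    intro S T hS hT a b ha hb h
    rw [ContinuousLinearMap.add_comp, ContinuousLinearMap.comp_add, hS a b ha hb h,
      hT a b ha hb h, add_zero]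
  smul_mem' := by
    intro c T hT a b ha hb h
    rw [ContinuousLinearMap.smul_comp, ContinuousLinearMap.comp_smul, hT a b ha hb h, smul_zero]

lemma maxBimodule_isMasaBimodule (μ : Measure X) (ν : Measure Y) (κ : Set (X × Y)) :
    IsMasaBimodule (maxBimodule μ ν κ) := by
  intro T hT f g a b ha hb h
  have e : projOp ν hb ∘L (mulOp g ∘L T ∘L mulOp f) ∘L projOp μ ha
      = mulOp g ∘L (projOp ν hb ∘L T ∘L projOp μ ha) ∘L mulOp f := by
    have h1 : projOp ν hb ∘L mulOp g = mulOp g ∘L projOp ν hb := mulOp_comm _ _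
    have h2 : mulOp f ∘L projOp μ ha = projOp μ ha ∘L mulOp f := mulOp_comm _ _
    calc _ = (projOp ν hb ∘L mulOp g) ∘L T ∘L (mulOp f ∘L projOp μ ha) := rfl
      _ = _ := by rw [h1, h2]; rfl
  rw [e, hT a b ha hb h]
  simp

/-- `κ` is an operator `M`-set: `𝔐_max(κ)` contains a non-zero compact operator. -/
def IsOperatorMSet (μ : Measure X) (ν : Measure Y) (κ : Set (X × Y)) : Prop :=
  ∃ T ∈ maxBimodule μ ν κ, IsCompactOperator T ∧ T ≠ 0

/-- `κ` is an operator `U`-set: an `ω`-closed set which is not an operator `M`-set. -/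
def IsOperatorUSet (μ : Measure X) (ν : Measure Y) (κ : Set (X × Y)) : Prop :=
  IsOmegaClosed μ ν κ ∧ ¬ IsOperatorMSet μ ν κ

end Operators

/-! ### Hilbert-Schmidt integral operators -/

section Kernel

variable {X Y : Type*} [MeasurableSpace X] [MeasurableSpace Y]
  {μ : Measure X} {ν : Measure Y} [SigmaFinite μ] [SigmaFinite ν]

lemma eLpNorm_two_rpow {Z : Type*} [MeasurableSpace Z] (θ : Measure Z) (f : Z → ℂ) :
    eLpNorm f 2 θ ^ (2 : ℝ) = ∫⁻ z, ‖f z‖ₑ ^ (2 : ℝ) ∂θ := by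
  have := eLpNorm_nnreal_pow_eq_lintegral (f := f) (μ := θ) (p := 2) two_ne_zero
  simpa using this

lemma eLpNorm_kernel_le {k : Y × X → ℂ} (hk : AEStronglyMeasurable k (ν.prod μ))
    {ξ : X → ℂ} (hξ : AEStronglyMeasurable ξ μ) :
    eLpNorm (fun y => ∫ x, k (y, x) * ξ x ∂μ) 2 ν ≤ eLpNorm k 2 (ν.prod μ) * eLpNorm ξ 2 μ := by
  have h2 : (0 : ℝ) < 2 := by norm_num
  rw [← ENNReal.rpow_le_rpow_iff h2, ENNReal.mul_rpow_of_nonneg _ _ h2.le, eLpNorm_two_rpow,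
    eLpNorm_two_rpow, lintegral_prod _ (hk.enorm.pow_const _),
    ← lintegral_mul_const'' _ (hk.enorm.pow_const (2 : ℝ)).lintegral_prod_right']
  refine lintegral_mono_ae ?_
  filter_upwards [hk.prodMk_left] with y hy
  calc ‖∫ x, k (y, x) * ξ x ∂μ‖ₑ ^ (2 : ℝ)
      ≤ (∫⁻ x, ‖k (y, x)‖ₑ * ‖ξ x‖ₑ ∂μ) ^ (2 : ℝ) := by
        refine ENNReal.rpow_le_rpow ((enorm_integral_le_lintegral_enorm _).trans_eq ?_) h2.le
        simp only [enorm_mul]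
    _ ≤ ((∫⁻ x, ‖k (y, x)‖ₑ ^ (2 : ℝ) ∂μ) ^ (1 / (2 : ℝ)) *
          (∫⁻ x, ‖ξ x‖ₑ ^ (2 : ℝ) ∂μ) ^ (1 / (2 : ℝ))) ^ (2 : ℝ) :=
        ENNReal.rpow_le_rpow (ENNReal.lintegral_mul_le_Lp_mul_Lq μ Real.HolderConjugate.two_two
          hy.enorm hξ.enorm) h2.le
    _ = (∫⁻ x, ‖k (y, x)‖ₑ ^ (2 : ℝ) ∂μ) * eLpNorm ξ 2 μ ^ (2 : ℝ) := by
        rw [eLpNorm_two_rpow, ENNReal.mul_rpow_of_nonneg _ _ h2.le, ← ENNReal.rpow_mul,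
          ← ENNReal.rpow_mul]
        norm_num

lemma memLp_kernel (k : Lp ℂ 2 (ν.prod μ)) (ξ : Lp ℂ 2 μ) :
    MemLp (fun y => ∫ x, k (y, x) * ξ x ∂μ) 2 ν := by
  refine ⟨?_, (eLpNorm_kernel_le (Lp.aestronglyMeasurable k)
    (Lp.aestronglyMeasurable ξ)).trans_lt
      (ENNReal.mul_lt_top (Lp.eLpNorm_lt_top k) (Lp.eLpNorm_lt_top ξ))⟩
  exact AEStronglyMeasurable.integral_prod_right'
    ((Lp.aestronglyMeasurable k).mul (Lp.aestronglyMeasurable ξ).comp_snd)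

lemma integrable_kernel (k : Lp ℂ 2 (ν.prod μ)) :
    ∀ᵐ y ∂ν, ∀ ξ : Lp ℂ 2 μ, Integrable (fun x => k (y, x) * ξ x) μ := by
  have hk := Lp.aestronglyMeasurable k
  have hfin : ∫⁻ y, ∫⁻ x, ‖k (y, x)‖ₑ ^ (2 : ℝ) ∂μ ∂ν ≠ ∞ := by
    rw [← lintegral_prod _ (hk.enorm.pow_const (2 : ℝ)), ← eLpNorm_two_rpow]
    exact ENNReal.rpow_ne_top_of_nonneg (by norm_num) (Lp.eLpNorm_lt_top k).ne
  filter_upwards [hk.prodMk_left,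
    ae_lt_top' (hk.enorm.pow_const (2 : ℝ)).lintegral_prod_right' hfin] with y hy hlt ξ
  have hm : MemLp (fun x => k (y, x)) 2 μ := by
    refine ⟨hy, ?_⟩
    rw [← eLpNorm_two_rpow] at hlt
    exact (ENNReal.rpow_lt_top_iff_of_pos (by norm_num)).1 hlt
  exact hm.integrable_mul (Lp.memLp ξ)

/-- The integral operator `T_k : L²(X, μ) → L²(Y, ν)`, `T_k ξ (y) = ∫ k(y, x) ξ(x) dμ(x)`, with
kernel `k ∈ L²(Y × X, ν × μ)`. -/
def kernelOp (k : Lp ℂ 2 (ν.prod μ)) : Lp ℂ 2 μ →L[ℂ] Lp ℂ 2 ν :=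
  LinearMap.mkContinuous
    { toFun := fun ξ => (memLp_kernel k ξ).toLp
      map_add' := by
        intro ξ η
        rw [← MemLp.toLp_add]
        apply MemLp.toLp_congr
        filter_upwards [integrable_kernel k] with y hy
        rw [Pi.add_apply, ← integral_add (hy ξ) (hy η)]
        apply integral_congr_ae
        filter_upwards [Lp.coeFn_add ξ η] with x hx
        rw [hx, Pi.add_apply, mul_add]
      map_smul' := by
        intro c ξ
        rw [RingHom.id_apply, ← MemLp.toLp_const_smul]
        apply MemLp.toLp_congr
        refine Eventually.of_forall fun y => ?_
        rw [Pi.smul_apply, smul_eq_mul, ← integral_const_mul]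
        apply integral_congr_ae
        filter_upwards [Lp.coeFn_smul c ξ] with x hx
        rw [hx, Pi.smul_apply, smul_eq_mul]
        ring }
    ‖k‖ (by
      intro ξ
      rw [LinearMap.coe_mk, AddHom.coe_mk, Lp.norm_toLp, Lp.norm_def, Lp.norm_def,
        ← ENNReal.toReal_mul]
      exact ENNReal.toReal_mono
        (ENNReal.mul_lt_top (Lp.eLpNorm_lt_top k) (Lp.eLpNorm_lt_top ξ)).ne
        (eLpNorm_kernel_le (Lp.aestronglyMeasurable k) (Lp.aestronglyMeasurable ξ)))

lemma kernelOp_ae (k : Lp ℂ 2 (ν.prod μ)) (ξ : Lp ℂ 2 μ) :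
    kernelOp k ξ =ᵐ[ν] fun y => ∫ x, k (y, x) * ξ x ∂μ :=
  (memLp_kernel k ξ).coeFn_toLp

end Kernel

/-! ### Schur multipliers, m-separable pairs and m-resolutions -/

section Schur

variable {X Y : Type*} [MeasurableSpace X] [MeasurableSpace Y]

/-- `φ` is a Schur multiplier: `φ` is measurable and the map `T_k ↦ T_{φ̂ k}`, where
`φ̂(y, x) = φ(x, y)`, defined for those `k ∈ L²(Y × X)` for which `φ̂ k ∈ L²(Y × X)`, is bounded in
the operator norm. -/
def IsSchurMultiplier (μ : Measure X) (ν : Measure Y) [SigmaFinite μ] [SigmaFinite ν]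
    (φ : X × Y → ℂ) : Prop :=
  Measurable φ ∧ ∃ C : ℝ, ∀ (k : Lp ℂ 2 (ν.prod μ))
    (hk : MemLp (fun p : Y × X => φ p.swap * k p) 2 (ν.prod μ)),
      ‖kernelOp hk.toLp‖ ≤ C * ‖kernelOp k‖

/-- The pair `(κ₁, κ₂)` is m-separable: some Schur multiplier is equal to `1` on an `ω`-open
neighbourhood of `κ₁` and to `0` on an `ω`-open neighbourhood of `κ₂`. As usual for Schur
multipliers, the two equalities are required up to marginally null sets. -/
def IsMSeparable (μ : Measure X) (ν : Measure Y) [SigmaFinite μ] [SigmaFinite ν]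
    (κ₁ κ₂ : Set (X × Y)) : Prop :=
  ∃ (φ : X × Y → ℂ) (E₁ E₂ : Set (X × Y)), IsSchurMultiplier μ ν φ ∧
    IsOmegaOpen μ ν E₁ ∧ IsOmegaOpen μ ν E₂ ∧ κ₁ ⊆ E₁ ∧ κ₂ ⊆ E₂ ∧
    MarginallyNull μ ν {p ∈ E₁ | φ p ≠ 1} ∧ MarginallyNull μ ν {p ∈ E₂ | φ p ≠ 0}

/-- `(κs β)`, `1 ≤ β ≤ α`, is an m-resolution of `κ`, where `α ≥ 1` is a countable ordinal (the
values of `κs` at other ordinals are irrelevant). -/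
structure IsMResolution (μ : Measure X) (ν : Measure Y) [SigmaFinite μ] [SigmaFinite ν]
    (κ : Set (X × Y)) (α : Ordinal.{0}) (κs : Ordinal.{0} → Set (X × Y)) : Prop where
  one_le : 1 ≤ α
  countable : α.card ≤ Cardinal.aleph0
  isOmegaClosed : ∀ β, 1 ≤ β → β ≤ α → IsOmegaClosed μ ν (κs β)
  first : κs 1 = κ
  subset : ∀ β, 1 ≤ β → β < α → κs (β + 1) ⊆ κs β
  diff_isOmegaClosed : ∀ β, 1 ≤ β → β < α → IsOmegaClosed μ ν (κs β \ κs (β + 1))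
  separable : ∀ β, 1 ≤ β → β < α → IsMSeparable μ ν (κs (β + 1)) (κs β \ κs (β + 1))
  limit : ∀ β, Order.IsSuccLimit β → β ≤ α → κs β = ⋂ (γ) (_ : 1 ≤ γ) (_ : γ < β), κs γ

end Schur

end

/-!
Let `T` be a compact operator supported on `κ`. By transfinite induction, `T` is supported on every
member `κ_β` of the m-resolution (`IsMResolution.supports`); since `κ_α` is an operator `U`-set,
`T = 0`.

At a successor, let `φ` be a Schur multiplier that is `1` near `κ_{β+1}` and `0` near
`κ_β \ κ_{β+1}`. Schur multiplication by `φ` extends from Hilbert–Schmidt to compact operators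
(`IsSchurMultiplier.exists_isCompactOperator`), because every compact operator is a norm limit of
operators `T_k` with `φ̂ k` square integrable, and the image `S` of `T` is again compact. Now `S` is
supported on `κ_{β+1}`, whereas `T - S` is compact and supported on the operator `U`-set
`κ_β \ κ_{β+1}`, so that `T = S` (`Supports.of_isMSeparable`).

At a limit, and also to pass from `φ` being `0` or `1` on `ω`-open sets to the supports of `S` and
`T - S`, one needs that an operator which vanishes on countably many `ω`-open sets vanishes on their
union (`VanishesOn.iUnion`). If a rectangle `a × b` is covered by countably many rectangles, then by
regularity of the measures almost all of `a` and of `b` is filled by compact sets `K` and `L` on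
which the sides of those rectangles are relatively open
(`exists_isCompact_isOpen_inter_eq`). So finitely many rectangles cover `K × L`, and for a finite
cover the claim is elementary.
-/

noncomputable section

/-! ### The projections `P(a)` -/

section Projections

variable {X : Type*} [MeasurableSpace X] {μ : Measure X}

lemma projOp_ae {a : Set X} (ha : MeasurableSet a) (ξ : Lp ℂ 2 μ) :
    projOp μ ha ξ =ᵐ[μ] a.indicator ξ := by
  filter_upwards [mulOp_ae (memLp_top_indicator_one μ ha).toLp ξ,
    (memLp_top_indicator_one μ ha).coeFn_toLp] with x h1 h2
  rw [projOp, h1, h2]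
  by_cases hx : x ∈ a <;> simp [hx]

lemma projOp_apply_projOp {a c : Set X} (ha : MeasurableSet a) (hc : MeasurableSet c)
    (ξ : Lp ℂ 2 μ) : projOp μ ha (projOp μ hc ξ) = projOp μ (ha.inter hc) ξ := by
  apply Lp.ext
  filter_upwards [projOp_ae ha (projOp μ hc ξ), projOp_ae hc ξ, projOp_ae (ha.inter hc) ξ]
    with x h1 h2 h3
  rw [h1, h3, ← Set.indicator_indicator]
  by_cases hx : x ∈ a <;> simp [hx, h2]

lemma projOp_inter_add_diff {a c : Set X} (ha : MeasurableSet a) (hc : MeasurableSet c)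
    (ξ : Lp ℂ 2 μ) :
    projOp μ (ha.inter hc) ξ + projOp μ (ha.diff hc) ξ = projOp μ ha ξ := by
  apply Lp.ext
  filter_upwards [Lp.coeFn_add (projOp μ (ha.inter hc) ξ) (projOp μ (ha.diff hc) ξ),
    projOp_ae (ha.inter hc) ξ, projOp_ae (ha.diff hc) ξ, projOp_ae ha ξ] with x h1 h2 h3 h4
  rw [h1, Pi.add_apply, h2, h3, h4]
  by_cases hx : x ∈ a <;> by_cases hx' : x ∈ c <;> simp [hx, hx']

lemma projOp_add_compl {a : Set X} (ha : MeasurableSet a) (ξ : Lp ℂ 2 μ) :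
    projOp μ ha ξ + projOp μ ha.compl ξ = ξ := by
  apply Lp.ext
  filter_upwards [Lp.coeFn_add (projOp μ ha ξ) (projOp μ ha.compl ξ), projOp_ae ha ξ,
    projOp_ae ha.compl ξ] with x h1 h2 h3
  rw [h1, Pi.add_apply, h2, h3, Set.indicator_self_add_compl_apply]

lemma projOp_congr {a a' : Set X} (ha : MeasurableSet a) (ha' : MeasurableSet a')
    (h : a =ᵐ[μ] a') : projOp μ ha = projOp μ ha' := by
  ext1 ξ
  apply Lp.ext
  exact (projOp_ae ha ξ).trans ((indicator_ae_eq_of_ae_eq_set h).trans (projOp_ae ha' ξ).symm)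

lemma projOp_apply_eq_zero {a : Set X} (ha : MeasurableSet a) (h : μ a = 0) (ξ : Lp ℂ 2 μ) :
    projOp μ ha ξ = 0 := by
  apply Lp.ext
  exact (projOp_ae ha ξ).trans ((indicator_meas_zero h).trans (Lp.coeFn_zero ℂ 2 μ).symm)

lemma norm_projOp_apply_le {a : Set X} (ha : MeasurableSet a) (ξ : Lp ℂ 2 μ) :
    ‖projOp μ ha ξ‖ ≤ ‖ξ‖ := by
  apply Lp.norm_le_norm_of_ae_le
  filter_upwards [projOp_ae ha ξ] with x hx
  rw [hx]
  exact norm_indicator_le_norm_self _ _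

lemma lintegral_enorm_sq_ne_top (ξ : Lp ℂ 2 μ) : ∫⁻ x, ‖ξ x‖ₑ ^ (2 : ℝ) ∂μ ≠ ∞ := by
  rw [← eLpNorm_two_rpow]
  exact ENNReal.rpow_ne_top_of_nonneg (by norm_num) (Lp.eLpNorm_lt_top ξ).ne

/-- `‖P(a) ξ‖²` is the mass that the finite measure `|ξ|² μ` gives to `a`. -/
lemma enorm_projOp_rpow {a : Set X} (ha : MeasurableSet a) (ξ : Lp ℂ 2 μ) :
    ‖projOp μ ha ξ‖ₑ ^ (2 : ℝ) = μ.withDensity (fun x => ‖ξ x‖ₑ ^ (2 : ℝ)) a := by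
  rw [Lp.enorm_def, eLpNorm_congr_ae (projOp_ae ha ξ), eLpNorm_indicator_eq_eLpNorm_restrict ha,
    eLpNorm_two_rpow, withDensity_apply _ ha]

lemma norm_projOp_apply_lt {a : Set X} (ha : MeasurableSet a) (ξ : Lp ℂ 2 μ) {ε : ℝ} (hε : 0 < ε)
    (h : μ.withDensity (fun x => ‖ξ x‖ₑ ^ (2 : ℝ)) a < ENNReal.ofReal ε ^ (2 : ℝ)) :
    ‖projOp μ ha ξ‖ < ε := by
  rw [← enorm_projOp_rpow ha, ENNReal.rpow_lt_rpow_iff (by norm_num), ← ofReal_norm] at h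
  exact (ENNReal.ofReal_lt_ofReal_iff hε).1 h

/-- `P(s n) ξ → 0` when the sets `s n` decrease to `∅`. -/
lemma exists_norm_projOp_apply_lt_of_antitone {s : ℕ → Set X} (hs : ∀ n, MeasurableSet (s n))
    (hanti : Antitone s) (hempty : ⋂ n, s n = ∅) (ξ : Lp ℂ 2 μ) {ε : ℝ} (hε : 0 < ε) :
    ∃ n, ‖projOp μ (hs n) ξ‖ < ε := by
  have : IsFiniteMeasure (μ.withDensity fun x => ‖ξ x‖ₑ ^ (2 : ℝ)) :=
    isFiniteMeasure_withDensity (lintegral_enorm_sq_ne_top ξ)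
  have ht := tendsto_measure_iInter_atTop (μ := μ.withDensity fun x => ‖ξ x‖ₑ ^ (2 : ℝ))
    (fun n => (hs n).nullMeasurableSet) hanti ⟨0, measure_ne_top _ _⟩
  rw [hempty, measure_empty] at ht
  have hpos : (0 : ℝ≥0∞) < ENNReal.ofReal ε ^ (2 : ℝ) :=
    ENNReal.rpow_pos (ENNReal.ofReal_pos.2 hε) ENNReal.ofReal_ne_top
  obtain ⟨n, hn⟩ := (ht.eventually (gt_mem_nhds hpos)).exists
  exact ⟨n, norm_projOp_apply_lt (hs n) ξ hε hn⟩

end Projections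

/-! ### Compact approximation of measurable sets -/

section Regularity

variable {X : Type*} [TopologicalSpace X] [T2Space X] [MeasurableSpace X] [BorelSpace X]
  {μ : Measure X} [μ.Regular] [SigmaFinite μ]

lemma exists_isCompact_withDensity_sdiff_lt {f : X → ℝ≥0∞} (hf : ∫⁻ x, f x ∂μ ≠ ∞) {A : Set X}
    (hA : MeasurableSet A) {ε : ℝ≥0∞} (hε : ε ≠ 0) :
    ∃ K ⊆ A, IsCompact K ∧ μ.withDensity f (A \ K) < ε := by
  have : IsFiniteMeasure (μ.withDensity f) := isFiniteMeasure_withDensity hf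
  have hε2 : ε / 2 ≠ 0 := (ENNReal.half_pos hε).ne'
  let S := spanningSets μ
  have hS : ∀ n, MeasurableSet (S n) := measurableSet_spanningSets μ
  have ht := tendsto_measure_iInter_atTop (μ := μ.withDensity f) (s := fun n => A \ S n)
    (fun n => (hA.diff (hS n)).nullMeasurableSet)
    (fun m n hmn => Set.sdiff_subset_sdiff_right (monotone_spanningSets μ hmn))
    ⟨0, measure_ne_top _ _⟩
  have hempty : ⋂ n, A \ S n = ∅ := by
    rw [← Set.sdiff_iUnion, iUnion_spanningSets, Set.sdiff_univ]
  rw [hempty, measure_empty] at ht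
  obtain ⟨n, hn⟩ := (ht.eventually (gt_mem_nhds (pos_iff_ne_zero.2 hε2))).exists
  obtain ⟨δ, hδ, hδ'⟩ := exists_pos_setLIntegral_lt_of_measure_lt hf hε2
  obtain ⟨K, hKA, hK, hKδ⟩ := (hA.inter (hS n)).exists_isCompact_sdiff_lt (μ := μ)
    (((measure_mono Set.inter_subset_right).trans_lt (measure_spanningSets_lt_top μ n)).ne) hδ.ne'
  refine ⟨K, hKA.trans Set.inter_subset_left, hK, ?_⟩
  have hsub : A \ K ⊆ (A \ S n) ∪ ((A ∩ S n) \ K) := by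
    rintro x ⟨hx, hxK⟩
    by_cases h : x ∈ S n
    · exact Or.inr ⟨⟨hx, h⟩, hxK⟩
    · exact Or.inl ⟨hx, h⟩
  calc μ.withDensity f (A \ K)
      ≤ μ.withDensity f (A \ S n) + μ.withDensity f ((A ∩ S n) \ K) :=
        (measure_mono hsub).trans (measure_union_le _ _)
    _ < ε / 2 + ε / 2 := by
        refine ENNReal.add_lt_add hn ?_
        rw [withDensity_apply _ ((hA.inter (hS n)).diff hK.measurableSet)]
        exact hδ' _ hKδ
    _ = ε := ENNReal.add_halves ε

/-- A Lusin type statement: up to an arbitrarily small set, a measurable set `A` is a compact set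
`K` on which countably many given measurable sets are relatively open. -/
lemma exists_isCompact_isOpen_inter_eq {f : X → ℝ≥0∞} (hf : ∫⁻ x, f x ∂μ ≠ ∞) {A : Set X}
    (hA : MeasurableSet A) {c : ℕ → Set X} (hc : ∀ n, MeasurableSet (c n)) {ε : ℝ≥0∞}
    (hε : ε ≠ 0) :
    ∃ K ⊆ A, IsCompact K ∧ μ.withDensity f (A \ K) < ε ∧
      ∃ U : ℕ → Set X, (∀ n, IsOpen (U n)) ∧ ∀ n, K ∩ U n = K ∩ c n := by
  obtain ⟨δ, hδ, hδε⟩ := ENNReal.exists_pos_sum_of_countable' hε ℕ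
  have hδ2 : ∀ n, δ n / 2 ≠ 0 := fun n => (ENNReal.half_pos (hδ n).ne').ne'
  choose K₁ hK₁A hK₁ hK₁lt using fun n =>
    exists_isCompact_withDensity_sdiff_lt hf (hA.inter (hc n)) (hδ2 n)
  choose K₂ hK₂A hK₂ hK₂lt using fun n =>
    exists_isCompact_withDensity_sdiff_lt hf (hA.diff (hc n)) (hδ2 n)
  have hcl : ∀ n, IsClosed (K₁ n ∪ K₂ n) := fun n => ((hK₁ n).union (hK₂ n)).isClosed
  refine ⟨⋂ n, (K₁ n ∪ K₂ n), ?_, ?_, ?_, fun n => (K₂ n)ᶜ, fun n => (hK₂ n).isClosed.isOpen_compl,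
    fun n => ?_⟩
  · exact (Set.iInter_subset _ 0).trans (Set.union_subset ((hK₁A 0).trans Set.inter_subset_left)
      ((hK₂A 0).trans Set.sdiff_subset))
  · exact ((hK₁ 0).union (hK₂ 0)).of_isClosed_subset (isClosed_iInter hcl) (Set.iInter_subset _ 0)
  · have hsub : A \ ⋂ n, (K₁ n ∪ K₂ n) ⊆ ⋃ n, ((A ∩ c n) \ K₁ n) ∪ ((A \ c n) \ K₂ n) := by
      rintro x ⟨hx, hxK⟩
      simp only [Set.mem_iInter, not_forall] at hxK
      obtain ⟨n, hn⟩ := hxK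
      rw [Set.mem_union, not_or] at hn
      refine Set.mem_iUnion.2 ⟨n, ?_⟩
      by_cases h : x ∈ c n
      · exact Or.inl ⟨⟨hx, h⟩, hn.1⟩
      · exact Or.inr ⟨⟨hx, h⟩, hn.2⟩
    calc _ ≤ ∑' n, μ.withDensity f (((A ∩ c n) \ K₁ n) ∪ ((A \ c n) \ K₂ n)) :=
          (measure_mono hsub).trans (measure_iUnion_le _)
      _ ≤ ∑' n, δ n := by
          refine ENNReal.tsum_le_tsum fun n => (measure_union_le _ _).trans ?_
          exact (add_le_add (hK₁lt n).le (hK₂lt n).le).trans (ENNReal.add_halves _).le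
      _ < ε := hδε
  · ext x
    simp only [Set.mem_inter_iff, Set.mem_compl_iff, and_congr_right_iff]
    intro hx
    refine ⟨fun h => ?_, fun h h' => (hK₂A n h').2 h⟩
    rcases Set.mem_iInter.1 hx n with h' | h'
    · exact (hK₁A n h').2
    · exact absurd h' h

end Regularity

/-! ### Operators vanishing on a set -/

section Vanishing

variable {X Y : Type*} [MeasurableSpace X] [MeasurableSpace Y]

lemma MarginallyNull.mono {μ : Measure X} {ν : Measure Y} {E F : Set (X × Y)}
    (hF : MarginallyNull μ ν F) (h : E ⊆ F) : MarginallyNull μ ν E := by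
  obtain ⟨X₀, Y₀, hX, hY, hsub⟩ := hF
  exact ⟨X₀, Y₀, hX, hY, h.trans hsub⟩

lemma MarginallyNull.iUnion {ι : Type*} [Countable ι] {μ : Measure X} {ν : Measure Y}
    {E : ι → Set (X × Y)} (h : ∀ i, MarginallyNull μ ν (E i)) : MarginallyNull μ ν (⋃ i, E i) := by
  choose X₀ Y₀ hX hY hsub using h
  refine ⟨⋃ i, X₀ i, ⋃ i, Y₀ i, measure_iUnion_null hX, measure_iUnion_null hY, ?_⟩
  refine Set.iUnion_subset fun i p hp => ?_
  rcases hsub i hp with h | h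
  · exact Or.inl (Set.mem_iUnion.2 ⟨i, h⟩)
  · exact Or.inr (Set.mem_iUnion.2 ⟨i, h⟩)

lemma MarginallyNull.union {μ : Measure X} {ν : Measure Y} {E F : Set (X × Y)}
    (hE : MarginallyNull μ ν E) (hF : MarginallyNull μ ν F) : MarginallyNull μ ν (E ∪ F) := by
  rw [Set.union_eq_iUnion]
  exact MarginallyNull.iUnion (Bool.forall_bool.2 ⟨hF, hE⟩)

/-- The operator `T` vanishes on `E`: `P(b) T P(a) = 0` for every measurable rectangle `a × b`
contained in `E` up to a marginally null set. -/
def VanishesOn (μ : Measure X) (ν : Measure Y) (T : Lp ℂ 2 μ →L[ℂ] Lp ℂ 2 ν)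
    (E : Set (X × Y)) : Prop :=
  ∀ (a : Set X) (b : Set Y) (ha : MeasurableSet a) (hb : MeasurableSet b),
    MarginallyNull μ ν ((a ×ˢ b) \ E) → ∀ ξ, projOp ν hb (T (projOp μ ha ξ)) = 0

lemma supports_iff_vanishesOn_compl {μ : Measure X} {ν : Measure Y} {κ : Set (X × Y)}
    {T : Lp ℂ 2 μ →L[ℂ] Lp ℂ 2 ν} : Supports μ ν κ T ↔ VanishesOn μ ν T κᶜ := by
  have key : ∀ (a : Set X) (b : Set Y),
      MarginallyEquiv μ ν ((a ×ˢ b) ∩ κ) ∅ ↔ MarginallyNull μ ν ((a ×ˢ b) \ κᶜ) := by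
    intro a b
    rw [MarginallyEquiv, Set.sdiff_compl, ← Set.bot_eq_empty, symmDiff_bot]
  simp only [Supports, VanishesOn, key, ContinuousLinearMap.ext_iff]
  rfl

lemma VanishesOn.sub {μ : Measure X} {ν : Measure Y} {E : Set (X × Y)}
    {S T : Lp ℂ 2 μ →L[ℂ] Lp ℂ 2 ν} (hS : VanishesOn μ ν S E) (hT : VanishesOn μ ν T E) :
    VanishesOn μ ν (S - T) E := by
  intro a b ha hb h ξ
  rw [sub_apply, map_sub, hS a b ha hb h, hT a b ha hb h, sub_zero]

lemma VanishesOn.mono {μ : Measure X} {ν : Measure Y} {E F : Set (X × Y)}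
    {T : Lp ℂ 2 μ →L[ℂ] Lp ℂ 2 ν} (hT : VanishesOn μ ν T F) (h : E ⊆ F) :
    VanishesOn μ ν T E := fun a b ha hb hab =>
  hT a b ha hb (hab.mono (Set.sdiff_subset_sdiff_right h))

/-- If `P(d) T P(c) = 0` for finitely many rectangles `c × d`, then `P(b) T P(a) = 0` for every
rectangle `a × b` that they cover. -/
lemma projOp_comp_eq_zero_of_finite_cover {μ : Measure X} {ν : Measure Y}
    {T : Lp ℂ 2 μ →L[ℂ] Lp ℂ 2 ν} {ι : Type*} {c : ι → Set X} {d : ι → Set Y}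
    (hc : ∀ i, MeasurableSet (c i)) (hd : ∀ i, MeasurableSet (d i))
    (hT : ∀ i ξ, projOp ν (hd i) (T (projOp μ (hc i) ξ)) = 0) (t : Finset ι) :
    ∀ (a : Set X) (b : Set Y) (ha : MeasurableSet a) (hb : MeasurableSet b),
      a ×ˢ b ⊆ ⋃ i ∈ t, c i ×ˢ d i → ∀ ξ, projOp ν hb (T (projOp μ ha ξ)) = 0 := by
  classical
  induction t using Finset.induction_on with
  | empty =>
    intro a b ha hb hsub ξ
    have hsub' : a ×ˢ b = ∅ := by simpa using hsub
    rcases Set.prod_eq_empty_iff.1 hsub' with h | h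
    · rw [projOp_apply_eq_zero ha (by rw [h, measure_empty]), map_zero, map_zero]
    · exact projOp_apply_eq_zero hb (by rw [h, measure_empty]) _
  | insert i t hi ih =>
    intro a b ha hb hsub ξ
    rw [Finset.set_biUnion_insert] at hsub
    -- Split `a` along `c i`, then `b` along `d i`: only `(a ∩ c i) × (b ∩ d i)` meets `c i × d i`.
    have h1 := ih (a \ c i) b (ha.diff (hc i)) hb (by
      rintro ⟨x, y⟩ ⟨⟨hx, hxc⟩, hy⟩
      exact (hsub ⟨hx, hy⟩).resolve_left fun h => hxc h.1) ξ
    have h2 := ih (a ∩ c i) (b \ d i) (ha.inter (hc i)) (hb.diff (hd i)) (by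
      rintro ⟨x, y⟩ ⟨⟨hx, hxc⟩, ⟨hy, hyd⟩⟩
      exact (hsub ⟨hx, hy⟩).resolve_left fun h => hyd h.2) ξ
    have h3 : projOp ν (hb.inter (hd i)) (T (projOp μ (ha.inter (hc i)) ξ)) = 0 := by
      have := hT i (projOp μ ha ξ)
      rw [projOp_apply_projOp] at this
      rw [← projOp_apply_projOp hb (hd i), projOp_congr (ha.inter (hc i)) ((hc i).inter ha)
        (Set.inter_comm _ _).eventuallyEq, this, map_zero]
    rw [← projOp_inter_add_diff ha (hc i) ξ, map_add, map_add, h1, add_zero,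
      ← projOp_inter_add_diff hb (hd i), h2, h3, add_zero]

variable [TopologicalSpace X] [T2Space X] [BorelSpace X] [TopologicalSpace Y] [T2Space Y]
  [BorelSpace Y] {μ : Measure X} [μ.Regular] [SigmaFinite μ] {ν : Measure Y} [ν.Regular]
  [SigmaFinite ν] {T : Lp ℂ 2 μ →L[ℂ] Lp ℂ 2 ν}

/-- The countable version of `projOp_comp_eq_zero_of_finite_cover`. The rectangle `a × b` is
exhausted by products of compact sets on which the cover is relatively open, and compactness leaves
finitely many rectangles. -/
lemma projOp_comp_eq_zero_of_countable_cover {c : ℕ → Set X} {d : ℕ → Set Y}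
    (hc : ∀ i, MeasurableSet (c i)) (hd : ∀ i, MeasurableSet (d i))
    (hT : ∀ i ξ, projOp ν (hd i) (T (projOp μ (hc i) ξ)) = 0) {a : Set X} {b : Set Y}
    (ha : MeasurableSet a) (hb : MeasurableSet b) (hsub : a ×ˢ b ⊆ ⋃ i, c i ×ˢ d i)
    (ξ : Lp ℂ 2 μ) : projOp ν hb (T (projOp μ ha ξ)) = 0 := by
  rw [← norm_le_zero_iff]
  refine le_of_forall_pos_le_add fun ε hε => ?_
  set η := T (projOp μ ha ξ) with hη
  have hpos : ∀ {δ : ℝ}, 0 < δ → ENNReal.ofReal δ ^ (2 : ℝ) ≠ 0 := fun hδ =>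
    (ENNReal.rpow_pos (ENNReal.ofReal_pos.2 hδ) ENNReal.ofReal_ne_top).ne'
  have hδ : 0 < ε / 2 / (‖T‖ + 1) := by positivity
  obtain ⟨K, hKa, hK, hKlt, U, hU, hKU⟩ := exists_isCompact_isOpen_inter_eq
    (lintegral_enorm_sq_ne_top ξ) ha hc (hpos hδ)
  obtain ⟨L, hLb, hL, hLlt, V, hV, hLV⟩ := exists_isCompact_isOpen_inter_eq
    (lintegral_enorm_sq_ne_top η) hb hd (hpos (half_pos hε))
  have hKLsub : K ×ˢ L ⊆ ⋃ i, U i ×ˢ V i := by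
    rintro ⟨x, y⟩ ⟨hx, hy⟩
    obtain ⟨i, hxi, hyi⟩ := Set.mem_iUnion.1 (hsub ⟨hKa hx, hLb hy⟩)
    have hx' : x ∈ K ∩ U i := (hKU i).symm ▸ ⟨hx, hxi⟩
    have hy' : y ∈ L ∩ V i := (hLV i).symm ▸ ⟨hy, hyi⟩
    exact Set.mem_iUnion.2 ⟨i, hx'.2, hy'.2⟩
  obtain ⟨t, ht⟩ := (hK.prod hL).elim_finite_subcover _ (fun i => (hU i).prod (hV i)) hKLsub
  have hzero := projOp_comp_eq_zero_of_finite_cover hc hd hT t K L hK.measurableSet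
    hL.measurableSet (by
      rintro ⟨x, y⟩ ⟨hx, hy⟩
      obtain ⟨i, hi, hxi, hyi⟩ := Set.mem_iUnion₂.1 (ht ⟨hx, hy⟩)
      have hx' : x ∈ K ∩ c i := hKU i ▸ ⟨hx, hxi⟩
      have hy' : y ∈ L ∩ d i := hLV i ▸ ⟨hy, hyi⟩
      exact Set.mem_iUnion₂.2 ⟨i, hi, hx'.2, hy'.2⟩) ξ
  -- Replacing `b` by `L` costs `ε / 2`, and replacing `a` by `K` costs `‖T‖ * (ε / 2 / (‖T‖ + 1))`.
  have hKn := norm_projOp_apply_lt (ha.diff hK.measurableSet) ξ hδ hKlt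
  have hLn := norm_projOp_apply_lt (hb.diff hL.measurableSet) η (half_pos hε) hLlt
  have ea : projOp μ ha ξ = projOp μ hK.measurableSet ξ
      + projOp μ (ha.diff hK.measurableSet) ξ := by
    rw [← projOp_inter_add_diff ha hK.measurableSet, projOp_congr (ha.inter hK.measurableSet)
      hK.measurableSet (Set.inter_eq_right.2 hKa).eventuallyEq]
  have eb : projOp ν hb η = projOp ν hL.measurableSet η
      + projOp ν (hb.diff hL.measurableSet) η := by
    rw [← projOp_inter_add_diff hb hL.measurableSet, projOp_congr (hb.inter hL.measurableSet)
      hL.measurableSet (Set.inter_eq_right.2 hLb).eventuallyEq]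
  have eL : projOp ν hL.measurableSet η
      = projOp ν hL.measurableSet (T (projOp μ (ha.diff hK.measurableSet) ξ)) := by
    rw [hη, ea, map_add, map_add, hzero, zero_add]
  have hfirst : ‖projOp ν hL.measurableSet η‖ ≤ ε / 2 := by
    rw [eL]
    calc _ ≤ ‖T (projOp μ (ha.diff hK.measurableSet) ξ)‖ := norm_projOp_apply_le _ _
      _ ≤ ‖T‖ * ‖projOp μ (ha.diff hK.measurableSet) ξ‖ := T.le_opNorm _
      _ ≤ (‖T‖ + 1) * (ε / 2 / (‖T‖ + 1)) := by gcongr; linarith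
      _ = ε / 2 := by field_simp
  rw [eb]
  linarith [norm_add_le (projOp ν hL.measurableSet η)
    (projOp ν (hb.diff hL.measurableSet) η)]

/-- An operator that vanishes on countably many `ω`-open sets vanishes on their union. -/
lemma VanishesOn.iUnion {ι : Type*} [Countable ι] [Nonempty ι] {E : ι → Set (X × Y)}
    (hE : ∀ i, IsOmegaOpen μ ν (E i)) (hT : ∀ i, VanishesOn μ ν T (E i)) :
    VanishesOn μ ν T (⋃ i, E i) := by
  intro a b ha hb hab ξ
  choose c d hc hd hcd using hE
  have hnull := hab.union (MarginallyNull.iUnion hcd)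
  obtain ⟨X₀, Y₀, hX₀, hY₀, hsub⟩ := hnull
  obtain ⟨e, he⟩ := exists_surjective_nat (ι × ℕ)
  -- Discarding null sets from `a` and `b` makes the cover exact.
  have ha' := ha.diff (measurableSet_toMeasurable μ X₀)
  have hb' := hb.diff (measurableSet_toMeasurable ν Y₀)
  have hX' : μ (toMeasurable μ X₀) = 0 := by rwa [measure_toMeasurable]
  have hY' : ν (toMeasurable ν Y₀) = 0 := by rwa [measure_toMeasurable]
  rw [projOp_congr ha ha' (sdiff_null_ae_eq_self hX').symm,
    projOp_congr hb hb' (sdiff_null_ae_eq_self hY').symm]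
  refine projOp_comp_eq_zero_of_countable_cover (fun n => hc (e n).1 (e n).2)
    (fun n => hd (e n).1 (e n).2) (fun n => hT (e n).1 _ _ _ _ ?_) ha' hb' ?_ ξ
  · refine (hcd (e n).1).mono fun p hp => Or.inr ⟨Set.mem_iUnion.2 ⟨_, hp.1⟩, hp.2⟩
  · rintro ⟨x, y⟩ ⟨⟨hx, hx'⟩, ⟨hy, hy'⟩⟩
    have hn : ((x, y) : X × Y) ∉ {p : X × Y | p.1 ∈ X₀ ∨ p.2 ∈ Y₀} := by
      rintro (h | h)
      · exact hx' (subset_toMeasurable _ _ h)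
      · exact hy' (subset_toMeasurable _ _ h)
    by_contra hcon
    refine hn (hsub ?_)
    by_cases hEx : ((x, y) : X × Y) ∈ ⋃ i, E i
    · obtain ⟨i, hi⟩ := Set.mem_iUnion.1 hEx
      refine Or.inr (Set.mem_iUnion.2 ⟨i, Or.inl ⟨hi, fun hmem => hcon ?_⟩⟩)
      obtain ⟨m, hm⟩ := Set.mem_iUnion.1 hmem
      obtain ⟨n, hn⟩ := he (i, m)
      exact Set.mem_iUnion.2 ⟨n, by rw [hn]; exact hm⟩
    · exact Or.inl ⟨⟨hx, hy⟩, hEx⟩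

lemma VanishesOn.union {E F : Set (X × Y)} (hE : IsOmegaOpen μ ν E) (hF : IsOmegaOpen μ ν F)
    (hTE : VanishesOn μ ν T E) (hTF : VanishesOn μ ν T F) : VanishesOn μ ν T (E ∪ F) := by
  rw [Set.union_eq_iUnion]
  exact VanishesOn.iUnion (Bool.forall_bool.2 ⟨hF, hE⟩) (Bool.forall_bool.2 ⟨hTF, hTE⟩)

end Vanishing

/-! ### Hilbert–Schmidt operators and compact operators -/

section Compact

variable {X Y : Type*} [MeasurableSpace X] [MeasurableSpace Y]
  {μ : Measure X} {ν : Measure Y} [SigmaFinite μ] [SigmaFinite ν]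

lemma kernelOp_add (k l : Lp ℂ 2 (ν.prod μ)) : kernelOp (k + l) = kernelOp k + kernelOp l := by
  ext1 ξ
  apply Lp.ext
  filter_upwards [kernelOp_ae (k + l) ξ, kernelOp_ae k ξ, kernelOp_ae l ξ,
    Lp.coeFn_add (kernelOp k ξ) (kernelOp l ξ), integrable_kernel k, integrable_kernel l,
    Measure.ae_ae_of_ae_prod (Lp.coeFn_add k l)] with y h1 h2 h3 h4 h5 h6 h7
  rw [add_apply, h1, h4, Pi.add_apply, h2, h3, ← integral_add (h5 ξ) (h6 ξ)]
  apply integral_congr_ae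
  filter_upwards [h7] with x hx
  rw [hx, Pi.add_apply, add_mul]

lemma kernelOp_smul (c : ℂ) (k : Lp ℂ 2 (ν.prod μ)) : kernelOp (c • k) = c • kernelOp k := by
  ext1 ξ
  apply Lp.ext
  filter_upwards [kernelOp_ae (c • k) ξ, kernelOp_ae k ξ, Lp.coeFn_smul c (kernelOp k ξ),
    Measure.ae_ae_of_ae_prod (Lp.coeFn_smul c k)] with y h1 h2 h3 h4
  rw [smul_apply, h1, h3, Pi.smul_apply, h2, smul_eq_mul, ← integral_const_mul]
  apply integral_congr_ae
  filter_upwards [h4] with x hx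
  rw [hx, Pi.smul_apply, smul_eq_mul, mul_assoc]

lemma norm_kernelOp_le (k : Lp ℂ 2 (ν.prod μ)) : ‖kernelOp k‖ ≤ ‖k‖ := by
  unfold kernelOp
  exact LinearMap.mkContinuous_norm_le _ (norm_nonneg k) _

variable (μ ν) in
/-- The linear map `k ↦ T_k`, a contraction from `L²(Y × X)` to the bounded operators. -/
def kernelOpL : Lp ℂ 2 (ν.prod μ) →L[ℂ] Lp ℂ 2 μ →L[ℂ] Lp ℂ 2 ν :=
  LinearMap.mkContinuous
    { toFun := kernelOp
      map_add' := kernelOp_add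
      map_smul' := kernelOp_smul } 1 (by
        intro k
        rw [one_mul]
        exact norm_kernelOp_le k)

@[simp] lemma kernelOpL_apply (k : Lp ℂ 2 (ν.prod μ)) : kernelOpL μ ν k = kernelOp k := rfl

lemma kernelOp_sub (k l : Lp ℂ 2 (ν.prod μ)) : kernelOp (k - l) = kernelOp k - kernelOp l :=
  map_sub (kernelOpL μ ν) k l

/-- Cutting the kernel down to `b × a` compresses the operator:
`P(b) T_k P(a) = T_{χ_{b × a} k}`. -/
lemma kernelOp_projOp_prod {a : Set X} {b : Set Y} (ha : MeasurableSet a) (hb : MeasurableSet b)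
    (k : Lp ℂ 2 (ν.prod μ)) :
    kernelOp (projOp (ν.prod μ) (hb.prod ha) k) = projOp ν hb ∘L kernelOp k ∘L projOp μ ha := by
  ext1 ξ
  apply Lp.ext
  filter_upwards [kernelOp_ae (projOp (ν.prod μ) (hb.prod ha) k) ξ,
    projOp_ae hb (kernelOp k (projOp μ ha ξ)), kernelOp_ae k (projOp μ ha ξ),
    Measure.ae_ae_of_ae_prod (projOp_ae (hb.prod ha) k)] with y h1 h2 h3 h4
  rw [ContinuousLinearMap.comp_apply, ContinuousLinearMap.comp_apply, h1, h2]
  by_cases hy : y ∈ b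
  · rw [Set.indicator_of_mem hy, h3]
    apply integral_congr_ae
    filter_upwards [h4, projOp_ae ha ξ] with x h5 h6
    rw [h5, h6]
    by_cases hx : x ∈ a <;> simp [hx, hy]
  · rw [Set.indicator_of_notMem hy]
    refine integral_eq_zero_of_ae ?_
    filter_upwards [h4] with x h5
    rw [h5]
    simp [hy]

omit [SigmaFinite ν] in
lemma memLp_two_mul_prod {g : Y → ℂ} {f : X → ℂ} (hg : MemLp g 2 ν) (hf : MemLp f 2 μ) :
    MemLp (fun p : Y × X => g p.1 * f p.2) 2 (ν.prod μ) := by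
  have h2 : (0 : ℝ) < 2 := by norm_num
  refine ⟨hg.1.comp_fst.mul hf.1.comp_snd, (ENNReal.rpow_lt_top_iff_of_pos h2).1 ?_⟩
  rw [eLpNorm_two_rpow]
  simp only [enorm_mul, ENNReal.mul_rpow_of_nonneg _ _ h2.le]
  rw [lintegral_prod_mul (hg.1.enorm.pow_const _) (hf.1.enorm.pow_const _), ← eLpNorm_two_rpow,
    ← eLpNorm_two_rpow]
  exact ENNReal.mul_lt_top (ENNReal.rpow_lt_top_of_nonneg h2.le hg.2.ne)
    (ENNReal.rpow_lt_top_of_nonneg h2.le hf.2.ne)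

lemma kernelOp_eq_rankOne {k : Lp ℂ 2 (ν.prod μ)} {g : Lp ℂ 2 ν} {f : Lp ℂ 2 μ}
    (hk : k =ᵐ[ν.prod μ] fun p => g p.1 * star (f p.2)) :
    kernelOp k = InnerProductSpace.rankOne ℂ g f := by
  ext1 ξ
  apply Lp.ext
  rw [InnerProductSpace.rankOne_apply]
  filter_upwards [kernelOp_ae k ξ, Lp.coeFn_smul (inner ℂ f ξ) g, Measure.ae_ae_of_ae_prod hk]
    with y h1 h2 h3
  rw [h1, h2, Pi.smul_apply, smul_eq_mul, mul_comm, L2.inner_def, ← integral_const_mul]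
  apply integral_congr_ae
  filter_upwards [h3] with x hx
  rw [hx, RCLike.inner_apply]
  simp only [RCLike.star_def]
  ring

lemma exists_kernelOp_eq_rankOne (g : Lp ℂ 2 ν) (f : Lp ℂ 2 μ) :
    ∃ k : Lp ℂ 2 (ν.prod μ), kernelOp k = InnerProductSpace.rankOne ℂ g f :=
  ⟨(memLp_two_mul_prod (Lp.memLp g) (Lp.memLp f).star).toLp,
    kernelOp_eq_rankOne (MemLp.coeFn_toLp _)⟩

lemma isCompactOperator_rankOne {E F : Type*} [NormedAddCommGroup E] [InnerProductSpace ℂ E]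
    [NormedAddCommGroup F] [InnerProductSpace ℂ F] (x : F) (y : E) :
    IsCompactOperator (InnerProductSpace.rankOne ℂ x y) := by
  rw [InnerProductSpace.rankOne_def']
  exact (isCompactOperator_of_locallyCompactSpace_dom (innerSL ℂ y)).clm_comp
    (.toSpanSingleton ℂ x : ℂ →L[ℂ] F)

lemma Submodule.mem_of_forall_exists_norm_sub_lt {E : Type*} [NormedAddCommGroup E]
    [NormedSpace ℂ E] {M : Submodule ℂ E} (hM : IsClosed (M : Set E)) {x : E}
    (h : ∀ ε > 0, ∃ y ∈ M, ‖x - y‖ < ε) : x ∈ M := by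
  have : x ∈ closure (M : Set E) := Metric.mem_closure_iff.2 fun ε hε => by
    obtain ⟨y, hy, hxy⟩ := h ε hε
    exact ⟨y, hy, by rwa [dist_eq_norm]⟩
  rwa [hM.closure_eq] at this

/-- A closed subspace of `L²` that contains the cut-downs of `k` to the members of a generating
`π`-system contains those to all measurable sets. -/
lemma projOp_mem_of_isPiSystem {Z : Type*} [m : MeasurableSpace Z] {θ : Measure Z}
    {M : Submodule ℂ (Lp ℂ 2 θ)} (hM : IsClosed (M : Set (Lp ℂ 2 θ))) {k : Lp ℂ 2 θ} (hk : k ∈ M)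
    {𝒮 : Set (Set Z)} (hgen : m = MeasurableSpace.generateFrom 𝒮) (hpi : IsPiSystem 𝒮)
    (hS : ∀ s ∈ 𝒮, ∀ hs : MeasurableSet s, projOp θ hs k ∈ M) {s : Set Z} (hs : MeasurableSet s) :
    projOp θ hs k ∈ M := by
  induction s, hs using MeasurableSpace.induction_on_inter hgen hpi with
  | empty =>
    rw [projOp_apply_eq_zero _ measure_empty]
    exact M.zero_mem
  | basic t ht => exact hS t ht _
  | compl t ht ih =>
    rw [eq_sub_of_add_eq' (projOp_add_compl ht k)]
    exact M.sub_mem hk ih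
  | iUnion f hdisj hf ih =>
    have hA : ∀ n, MeasurableSet (⋃ i < n, f i) := fun n =>
      .iUnion fun i => .iUnion fun _ => hf i
    have hmem : ∀ n, projOp θ (hA n) k ∈ M := by
      intro n
      induction n with
      | zero =>
        rw [projOp_apply_eq_zero _ (by simp)]
        exact M.zero_mem
      | succ n ihn =>
        have h1 : (⋃ i < n + 1, f i) ∩ f n = f n := by
          rw [Set.biUnion_lt_succ, Set.inter_eq_right]
          exact Set.subset_union_right
        have h2 : (⋃ i < n + 1, f i) \ f n = ⋃ i < n, f i := by
          rw [Set.biUnion_lt_succ, Set.union_sdiff_right]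
          refine Disjoint.sdiff_eq_left (Set.disjoint_iUnion₂_left.2 fun i hi => ?_)
          exact hdisj hi.ne
        rw [← projOp_inter_add_diff (hA (n + 1)) (hf n), projOp_congr _ (hf n) h1.eventuallyEq,
          projOp_congr _ (hA n) h2.eventuallyEq]
        exact M.add_mem (ih n) ihn
    refine Submodule.mem_of_forall_exists_norm_sub_lt hM fun ε hε => ?_
    have hU := MeasurableSet.iUnion hf
    obtain ⟨n, hn⟩ := exists_norm_projOp_apply_lt_of_antitone
      (s := fun n => (⋃ i, f i) \ ⋃ i < n, f i) (fun n => hU.diff (hA n))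
      (fun p q hpq => Set.sdiff_subset_sdiff_right
        (Set.biUnion_subset_biUnion_left fun i hi => lt_of_lt_of_le hi hpq))
      (by
        rw [← Set.sdiff_iUnion, Set.sdiff_eq_empty]
        refine Set.iUnion_subset fun i => ?_
        exact (Set.subset_iUnion₂ (s := fun j (_ : j < i + 1) => f j) i (Nat.lt_succ_self i)).trans
          (Set.subset_iUnion (fun n => ⋃ i < n, f i) (i + 1))) k hε
    refine ⟨_, hmem n, ?_⟩
    have h1 : (⋃ i, f i) ∩ ⋃ i < n, f i = ⋃ i < n, f i :=
      Set.inter_eq_right.2 (Set.iUnion₂_subset fun i _ => Set.subset_iUnion f i)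
    rwa [← projOp_inter_add_diff hU (hA n) k, projOp_congr _ (hA n) h1.eventuallyEq,
      add_sub_cancel_left]

/-- Hilbert–Schmidt operators are compact. The kernels of compact operators form a closed subspace
of `L²(Y × X)` which contains the indicator functions of rectangles of finite measure. -/
theorem isCompactOperator_kernelOp (k : Lp ℂ 2 (ν.prod μ)) : IsCompactOperator (kernelOp k) := by
  set M : Submodule ℂ (Lp ℂ 2 (ν.prod μ)) :=
    (compactOperator (RingHom.id ℂ) (Lp ℂ 2 μ) (Lp ℂ 2 ν)).comap (kernelOpL μ ν).toLinearMap
  have hmem : ∀ k, k ∈ M ↔ IsCompactOperator (kernelOp k) := fun k => Iff.rfl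
  have hM : IsClosed (M : Set (Lp ℂ 2 (ν.prod μ))) :=
    isClosed_setOfPred_isCompactOperator.preimage (kernelOpL μ ν).continuous
  have hrect : ∀ {a : Set X} {b : Set Y} (ha : MeasurableSet a) (hb : MeasurableSet b)
      (hμa : μ a ≠ ∞) (hνb : ν b ≠ ∞) (hab : (ν.prod μ) (b ×ˢ a) ≠ ∞),
      indicatorConstLp 2 (hb.prod ha) hab (1 : ℂ) ∈ M := by
    intro a b ha hb hμa hνb hab
    rw [hmem, kernelOp_eq_rankOne (g := indicatorConstLp 2 hb hνb (1 : ℂ))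
      (f := indicatorConstLp 2 ha hμa (1 : ℂ))]
    · exact isCompactOperator_rankOne _ _
    · filter_upwards [
        indicatorConstLp_coeFn (p := 2) (hs := hb.prod ha) (hμs := hab) (c := (1 : ℂ)),
        Measure.quasiMeasurePreserving_fst.ae
          (indicatorConstLp_coeFn (p := 2) (hs := hb) (hμs := hνb) (c := (1 : ℂ))),
        Measure.quasiMeasurePreserving_snd.ae
          (indicatorConstLp_coeFn (p := 2) (hs := ha) (hμs := hμa) (c := (1 : ℂ)))]
        with p h1 h2 h3
      rw [h1, h2, h3]
      by_cases hx : p.1 ∈ b <;> by_cases hy : p.2 ∈ a <;> simp [Set.indicator, hx, hy]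
  have hcut : ∀ {a : Set X} {b : Set Y} (ha : MeasurableSet a) (hb : MeasurableSet b)
      {k : Lp ℂ 2 (ν.prod μ)}, k ∈ M → projOp (ν.prod μ) (hb.prod ha) k ∈ M := by
    intro a b ha hb k hk
    rw [hmem, kernelOp_projOp_prod ha hb]
    exact (((hmem k).1 hk).comp_clm (projOp μ ha)).clm_comp (projOp ν hb)
  have hset : ∀ {s : Set (Y × X)} (hs : MeasurableSet s) {k : Lp ℂ 2 (ν.prod μ)}, k ∈ M →
      projOp (ν.prod μ) hs k ∈ M := by
    intro s hs k hk
    refine projOp_mem_of_isPiSystem hM hk generateFrom_prod.symm isPiSystem_prod ?_ hs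
    rintro _ ⟨b, hb, a, ha, rfl⟩ _
    exact hcut ha hb hk
  suffices k ∈ M from this
  induction k using Lp.induction (by norm_num : (2 : ℝ≥0∞) ≠ ∞) with
  | indicatorConst c hs hμs =>
    rename_i s
    rw [Lp.simpleFunc.coe_indicatorConst]
    refine Submodule.mem_of_forall_exists_norm_sub_lt hM fun ε hε => ?_
    let R : ℕ → Set (Y × X) := fun n => spanningSets ν n ×ˢ spanningSets μ n
    have hR : ∀ n, MeasurableSet (R n) := fun n =>
      (measurableSet_spanningSets ν n).prod (measurableSet_spanningSets μ n)
    have hRtop : ∀ n, (ν.prod μ) (R n) ≠ ∞ := fun n => by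
      rw [Measure.prod_prod]
      exact (ENNReal.mul_lt_top (measure_spanningSets_lt_top ν n)
        (measure_spanningSets_lt_top μ n)).ne
    have hRmono : Monotone R := fun m n hmn =>
      Set.prod_mono (monotone_spanningSets ν hmn) (monotone_spanningSets μ hmn)
    have hRU : ⋃ n, R n = Set.univ := by
      rw [Set.iUnion_prod_of_monotone (monotone_spanningSets ν) (monotone_spanningSets μ),
        iUnion_spanningSets, iUnion_spanningSets, Set.univ_prod_univ]
    obtain ⟨n, hn⟩ := exists_norm_projOp_apply_lt_of_antitone (s := fun n => (R n)ᶜ)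
      (fun n => (hR n).compl) (fun p q hpq => Set.compl_subset_compl.2 (hRmono hpq))
      (by rw [← Set.compl_iUnion, hRU, Set.compl_univ]) (indicatorConstLp 2 hs hμs.ne c) hε
    refine ⟨c • projOp (ν.prod μ) hs (indicatorConstLp 2 (hR n) (hRtop n) (1 : ℂ)),
      M.smul_mem c (hset hs (hrect (measurableSet_spanningSets μ n)
        (measurableSet_spanningSets ν n) (measure_spanningSets_lt_top μ n).ne
        (measure_spanningSets_lt_top ν n).ne (hRtop n))), ?_⟩
    refine (congrArg norm (Lp.ext ?_)).trans_lt hn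
    filter_upwards [Lp.coeFn_sub (indicatorConstLp 2 hs hμs.ne c)
        (c • projOp (ν.prod μ) hs (indicatorConstLp 2 (hR n) (hRtop n) (1 : ℂ))),
      Lp.coeFn_smul c (projOp (ν.prod μ) hs (indicatorConstLp 2 (hR n) (hRtop n) (1 : ℂ))),
      projOp_ae hs (indicatorConstLp 2 (hR n) (hRtop n) (1 : ℂ)),
      indicatorConstLp_coeFn (p := 2) (hs := hR n) (hμs := hRtop n) (c := (1 : ℂ)),
      indicatorConstLp_coeFn (p := 2) (hs := hs) (hμs := hμs.ne) (c := c),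
      projOp_ae (hR n).compl (indicatorConstLp 2 hs hμs.ne c)] with p h1 h2 h3 h4 h5 h6
    rw [h1, Pi.sub_apply, h2, Pi.smul_apply, h3, h6]
    by_cases hp : p ∈ s <;> by_cases hp' : p ∈ R n <;> simp [Set.indicator, h4, h5, hp, hp']
  | add hf hg _ ihf ihg => exact M.add_mem ihf ihg
  | isClosed => exact hM

/-- Hilbert–Schmidt operators are norm dense in the compact operators: compose with the orthogonal
projection onto the span of a finite `ε`-net of the image of the unit ball. -/
theorem IsCompactOperator.exists_norm_sub_kernelOp_lt {T : Lp ℂ 2 μ →L[ℂ] Lp ℂ 2 ν}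
    (hT : IsCompactOperator T) {ε : ℝ} (hε : 0 < ε) :
    ∃ k : Lp ℂ 2 (ν.prod μ), ‖T - kernelOp k‖ < ε := by
  have htb : TotallyBounded (T '' Metric.closedBall 0 1) :=
    ((hT.isCompact_closure_image_closedBall (f := T.toLinearMap) 1).totallyBounded).subset
      subset_closure
  obtain ⟨t, ht, hsub⟩ := Metric.totallyBounded_iff.1 htb (ε / 2) (half_pos hε)
  let V : Submodule ℂ (Lp ℂ 2 ν) := Submodule.span ℂ t
  have : FiniteDimensional ℂ V := FiniteDimensional.span_of_finite ℂ ht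
  choose k hk using fun i =>
    exists_kernelOp_eq_rankOne (μ := μ) (stdOrthonormalBasis ℂ V i : Lp ℂ 2 ν)
      (ContinuousLinearMap.adjoint T (stdOrthonormalBasis ℂ V i : Lp ℂ 2 ν))
  refine ⟨∑ i, k i, ?_⟩
  have hsum : kernelOp (∑ i, k i) = V.starProjection ∘L T := by
    rw [← kernelOpL_apply, map_sum, (stdOrthonormalBasis ℂ V).starProjection_eq_sum_rankOne,
      ContinuousLinearMap.finsetSum_comp]
    refine Finset.sum_congr rfl fun i _ => ?_
    rw [kernelOpL_apply, hk, InnerProductSpace.rankOne_comp]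
  rw [hsum]
  refine lt_of_le_of_lt (ContinuousLinearMap.opNorm_le_of_unit_norm (half_pos hε).le ?_)
    (half_lt_self hε)
  intro ξ hξ
  obtain ⟨v, hv, hv'⟩ := Set.mem_iUnion₂.1 (hsub ⟨ξ, by simp [hξ], rfl⟩)
  have hvV : v ∈ V := Submodule.subset_span hv
  calc ‖(T - V.starProjection ∘L T) ξ‖ = ‖T ξ - V.starProjection (T ξ)‖ := rfl
    _ ≤ ‖T ξ - v‖ := by
        rw [Submodule.starProjection_minimal]
        exact ciInf_le ⟨0, by rintro _ ⟨w, rfl⟩; exact norm_nonneg _⟩ (⟨v, hvV⟩ : V)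
    _ ≤ ε / 2 := by
        rw [← dist_eq_norm]
        exact (Metric.mem_ball.1 hv').le

end Compact

/-! ### Schur multiplication of compact operators -/

section SchurCompact

variable {X Y : Type*} [MeasurableSpace X] [MeasurableSpace Y]
  {μ : Measure X} {ν : Measure Y} [SigmaFinite μ] [SigmaFinite ν]

omit [SigmaFinite μ] [SigmaFinite ν] in
lemma MarginallyNull.ae_swap_notMem {E : Set (X × Y)} (hE : MarginallyNull μ ν E) :
    ∀ᵐ p ∂(ν.prod μ), p.swap ∉ E := by
  obtain ⟨X₀, Y₀, hX, hY, hsub⟩ := hE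
  filter_upwards [Measure.quasiMeasurePreserving_fst.ae (measure_eq_zero_iff_ae_notMem.1 hY),
    Measure.quasiMeasurePreserving_snd.ae (measure_eq_zero_iff_ae_notMem.1 hX)] with p h1 h2 hp
  exact (hsub hp).elim h2 h1

/-- Compact operators are norm limits of Hilbert–Schmidt operators `T_k` such that `φ̂ k` is square
integrable, whatever the measurable function `φ`: cut `k` down to `{|φ̂| ≤ n}`. -/
lemma IsCompactOperator.exists_norm_sub_kernelOp_lt_of_measurable {T : Lp ℂ 2 μ →L[ℂ] Lp ℂ 2 ν}
    (hT : IsCompactOperator T) {φ : X × Y → ℂ} (hφ : Measurable φ) {ε : ℝ} (hε : 0 < ε) :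
    ∃ k : Lp ℂ 2 (ν.prod μ), MemLp (fun p : Y × X => φ p.swap * k p) 2 (ν.prod μ) ∧
      ‖T - kernelOp k‖ < ε := by
  obtain ⟨k, hk⟩ := hT.exists_norm_sub_kernelOp_lt (half_pos hε)
  have hφ' : Measurable fun p : Y × X => φ p.swap := hφ.comp measurable_swap
  let s : ℕ → Set (Y × X) := fun n => {p | ‖φ p.swap‖ ≤ n}
  have hs : ∀ n, MeasurableSet (s n) := fun n => measurableSet_le hφ'.norm measurable_const
  obtain ⟨n, hn⟩ := exists_norm_projOp_apply_lt_of_antitone (s := fun n => (s n)ᶜ)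
    (fun n => (hs n).compl)
    (fun p q hpq => Set.compl_subset_compl.2 fun z hz =>
      le_trans (show ‖φ z.swap‖ ≤ p from hz) (Nat.cast_le.2 hpq))
    (by
      rw [← Set.compl_iUnion, Set.compl_empty_iff, Set.eq_univ_iff_forall]
      exact fun z => Set.mem_iUnion.2 (exists_nat_ge ‖φ z.swap‖)) k (half_pos hε)
  refine ⟨projOp _ (hs n) k, ?_, ?_⟩
  · refine MemLp.of_le_mul (c := n) (Lp.memLp k)
      (hφ'.aestronglyMeasurable.mul (Lp.aestronglyMeasurable _)) ?_
    filter_upwards [projOp_ae (hs n) k] with p hp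
    rw [hp, norm_mul]
    by_cases h : p ∈ s n
    · rw [Set.indicator_of_mem h]
      exact mul_le_mul_of_nonneg_right h (norm_nonneg _)
    · rw [Set.indicator_of_notMem h, norm_zero, mul_zero]
      positivity
  · have h1 : k - projOp _ (hs n) k = projOp _ (hs n).compl k :=
      (eq_sub_of_add_eq' (projOp_add_compl (hs n) k)).symm
    have h2 : T - kernelOp (projOp _ (hs n) k)
        = (T - kernelOp k) + kernelOp (projOp _ (hs n).compl k) := by
      rw [← h1, kernelOp_sub]
      abel
    rw [h2]
    linarith [norm_add_le (T - kernelOp k) (kernelOp (projOp _ (hs n).compl k)),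
      norm_kernelOp_le (projOp _ (hs n).compl k)]

/-- Schur multiplication by `φ` extends from Hilbert–Schmidt operators to compact operators. The
image `S` of `T` vanishes where `T` does and where `φ = 0`, and it agrees with `T` where `φ = 1`. -/
theorem IsSchurMultiplier.exists_isCompactOperator {φ : X × Y → ℂ} (hφ : IsSchurMultiplier μ ν φ)
    {T : Lp ℂ 2 μ →L[ℂ] Lp ℂ 2 ν} (hT : IsCompactOperator T) :
    ∃ S : Lp ℂ 2 μ →L[ℂ] Lp ℂ 2 ν, IsCompactOperator S ∧
      (∀ E, VanishesOn μ ν T E → VanishesOn μ ν S E) ∧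
      (∀ E, MarginallyNull μ ν {p ∈ E | φ p ≠ 0} → VanishesOn μ ν S E) ∧
      (∀ E, MarginallyNull μ ν {p ∈ E | φ p ≠ 1} → VanishesOn μ ν (T - S) E) := by
  obtain ⟨hmeas, C, hC⟩ := hφ
  choose k hk hkT using fun n : ℕ =>
    hT.exists_norm_sub_kernelOp_lt_of_measurable hmeas (Nat.one_div_pos_of_nat (α := ℝ) (n := n))
  let l : ℕ → Lp ℂ 2 (ν.prod μ) := fun n => (hk n).toLp
  have hl : ∀ n, l n =ᵐ[ν.prod μ] fun p => φ p.swap * k n p := fun n => (hk n).coeFn_toLp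
  have hkTlim : Tendsto (fun n => kernelOp (k n)) atTop (nhds T) := by
    rw [tendsto_iff_norm_sub_tendsto_zero]
    refine squeeze_zero (fun _ => norm_nonneg _) (fun n => ?_)
      tendsto_one_div_add_atTop_nhds_zero_nat
    rw [norm_sub_rev]
    exact (hkT n).le
  have hbound : ∀ k' l' : Lp ℂ 2 (ν.prod μ), (l' =ᵐ[ν.prod μ] fun p => φ p.swap * k' p) →
      ‖kernelOp l'‖ ≤ C * ‖kernelOp k'‖ := by
    intro k' l' h
    have hm : MemLp (fun p : Y × X => φ p.swap * k' p) 2 (ν.prod μ) :=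
      (memLp_congr_ae h).1 (Lp.memLp l')
    have : l' = hm.toLp := Lp.ext (h.trans hm.coeFn_toLp.symm)
    rw [this]
    exact hC k' hm
  -- The bound, applied to `k m - k n`, makes the images a Cauchy sequence; `C` may be negative.
  have hcauchy : CauchySeq fun n => kernelOp (l n) := by
    rw [Metric.cauchySeq_iff]
    intro ε hε
    obtain ⟨N, hN⟩ := Metric.cauchySeq_iff.1 hkTlim.cauchySeq (ε / (|C| + 1)) (by positivity)
    refine ⟨N, fun m hm n hn => ?_⟩
    have h := hN m hm n hn
    rw [dist_eq_norm, ← kernelOp_sub] at h ⊢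
    calc ‖kernelOp (l m - l n)‖ ≤ C * ‖kernelOp (k m - k n)‖ := by
          refine hbound _ _ ?_
          filter_upwards [hl m, hl n, Lp.coeFn_sub (l m) (l n), Lp.coeFn_sub (k m) (k n)]
            with p h1 h2 h3 h4
          rw [h3, h4, Pi.sub_apply, Pi.sub_apply, h1, h2, mul_sub]
      _ ≤ (|C| + 1) * ‖kernelOp (k m - k n)‖ := by
          gcongr
          linarith [le_abs_self C]
      _ < (|C| + 1) * (ε / (|C| + 1)) := by gcongr
      _ = ε := by field_simp
  obtain ⟨S, hS⟩ := cauchySeq_tendsto_of_complete hcauchy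
  have hcomp : ∀ {a : Set X} {b : Set Y} (ha : MeasurableSet a) (hb : MeasurableSet b)
      {k' : ℕ → Lp ℂ 2 (ν.prod μ)} {T' : Lp ℂ 2 μ →L[ℂ] Lp ℂ 2 ν},
      Tendsto (fun n => kernelOp (k' n)) atTop (nhds T') →
      Tendsto (fun n => kernelOp (projOp (ν.prod μ) (hb.prod ha) (k' n))) atTop
        (nhds (projOp ν hb ∘L T' ∘L projOp μ ha)) := by
    intro a b ha hb k' T' h
    simp only [kernelOp_projOp_prod ha hb]
    have hcont : Continuous fun R : Lp ℂ 2 μ →L[ℂ] Lp ℂ 2 ν =>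
        projOp ν hb ∘L R ∘L projOp μ ha :=
      continuous_const.clm_comp (continuous_id.clm_comp continuous_const)
    exact (hcont.tendsto T').comp h
  have hvanish : ∀ {k' : ℕ → Lp ℂ 2 (ν.prod μ)} {T' : Lp ℂ 2 μ →L[ℂ] Lp ℂ 2 ν},
      Tendsto (fun n => kernelOp (k' n)) atTop (nhds T') → ∀ {E : Set (X × Y)},
      (∀ n, ∀ᵐ p ∂(ν.prod μ), p.swap ∈ E → k' n p = 0) → VanishesOn μ ν T' E := by
    intro k' T' h E hE a b ha hb hab ξ
    have hzero : ∀ n, projOp (ν.prod μ) (hb.prod ha) (k' n) = 0 := by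
      intro n
      apply Lp.ext
      filter_upwards [projOp_ae (hb.prod ha) (k' n), hE n, hab.ae_swap_notMem,
        Lp.coeFn_zero ℂ 2 (ν.prod μ)] with p h1 h2 h3 h4
      rw [h1, h4, Pi.zero_apply, Set.indicator_apply_eq_zero]
      intro hp
      exact h2 (by_contra fun hpE => h3 ⟨⟨hp.2, hp.1⟩, hpE⟩)
    have hlim := hcomp ha hb h
    simp only [hzero, ← kernelOpL_apply, map_zero] at hlim
    exact DFunLike.congr_fun (tendsto_nhds_unique hlim tendsto_const_nhds) ξ
  refine ⟨S, isCompactOperator_of_tendsto hS (Eventually.of_forall fun n =>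
    isCompactOperator_kernelOp (l n)), ?_, ?_, ?_⟩
  · intro E hE a b ha hb hab ξ
    have hTzero : projOp ν hb ∘L T ∘L projOp μ ha = 0 := by
      ext1 η
      exact hE a b ha hb hab η
    have hlim := (hcomp ha hb hkTlim).norm.const_mul C
    rw [hTzero, norm_zero, mul_zero] at hlim
    have hle := le_of_tendsto_of_tendsto' (hcomp ha hb hS).norm hlim fun n => hbound _ _ (by
      filter_upwards [projOp_ae (hb.prod ha) (l n), projOp_ae (hb.prod ha) (k n), hl n]
        with p h1 h2 h3
      rw [h1, h2]
      by_cases hp : p ∈ b ×ˢ a <;> simp [hp, h3])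
    exact DFunLike.congr_fun (norm_le_zero_iff.1 hle) ξ
  · intro E hE
    refine hvanish hS fun n => ?_
    filter_upwards [hl n, hE.ae_swap_notMem] with p h1 h2 hp
    rw [h1, not_not.1 fun h => h2 ⟨hp, h⟩, zero_mul]
  · intro E hE
    have hlim : Tendsto (fun n => kernelOp (k n - l n)) atTop (nhds (T - S)) := by
      simp only [kernelOp_sub]
      exact hkTlim.sub hS
    refine hvanish hlim fun n => ?_
    filter_upwards [hl n, hE.ae_swap_notMem, Lp.coeFn_sub (k n) (l n)] with p h1 h2 h3 hp
    rw [h3, Pi.sub_apply, h1, not_not.1 fun h => h2 ⟨hp, h⟩, one_mul, sub_self]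

end SchurCompact

/-! ### Operators supported along an m-resolution -/

section Resolution

variable {X Y : Type*} [TopologicalSpace X] [T2Space X] [MeasurableSpace X] [BorelSpace X]
  [TopologicalSpace Y] [T2Space Y] [MeasurableSpace Y] [BorelSpace Y]
  {μ : Measure X} [μ.Regular] [SigmaFinite μ] {ν : Measure Y} [ν.Regular] [SigmaFinite ν]

/-- If `κ` is the union of an m-separable pair `κ₁`, `κ \ κ₁` and `κ \ κ₁` is an operator `U`-set,
then a compact operator supported on `κ` is supported on `κ₁`: Schur multiplication splits it into
a part supported on `κ₁` and a compact part supported on `κ \ κ₁`, and the latter is zero. -/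
theorem Supports.of_isMSeparable {κ κ₁ : Set (X × Y)} (hκ : IsOmegaClosed μ ν κ)
    (hsep : IsMSeparable μ ν κ₁ (κ \ κ₁)) (hU : ¬ IsOperatorMSet μ ν (κ \ κ₁))
    {T : Lp ℂ 2 μ →L[ℂ] Lp ℂ 2 ν} (hT : IsCompactOperator T) (hTκ : Supports μ ν κ T) :
    Supports μ ν κ₁ T := by
  obtain ⟨φ, E₁, E₂, hφ, hE₁, hE₂, hsub₁, hsub₂, h1, h0⟩ := hsep
  obtain ⟨S, hS, hTS, hS0, hS1⟩ := hφ.exists_isCompactOperator hT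
  have hTκ' := supports_iff_vanishesOn_compl.1 hTκ
  have hSκ₁ : Supports μ ν κ₁ S := by
    refine supports_iff_vanishesOn_compl.2
      ((VanishesOn.union hκ hE₂ (hTS _ hTκ') (hS0 _ h0)).mono fun p hp => ?_)
    by_cases hpκ : p ∈ κ
    · exact Or.inr (hsub₂ ⟨hpκ, hp⟩)
    · exact Or.inl hpκ
  have hdiff : Supports μ ν (κ \ κ₁) (T - S) := by
    refine supports_iff_vanishesOn_compl.2
      ((VanishesOn.union hκ hE₁ (hTκ'.sub (hTS _ hTκ')) (hS1 _ h1)).mono fun p hp => ?_)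
    by_cases hpκ : p ∈ κ
    · exact Or.inr (hsub₁ (by_contra fun h => hp ⟨hpκ, h⟩))
    · exact Or.inl hpκ
  have hzero : T - S = 0 := by
    by_contra hne
    exact hU ⟨T - S, hdiff, hT.sub hS, hne⟩
  rwa [sub_eq_zero.1 hzero]

/-- A bounded operator supported on countably many `ω`-closed sets is supported on their
intersection. -/
theorem Supports.iInter {ι : Type*} [Countable ι] [Nonempty ι] {κ : ι → Set (X × Y)}
    (hκ : ∀ i, IsOmegaClosed μ ν (κ i)) {T : Lp ℂ 2 μ →L[ℂ] Lp ℂ 2 ν}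
    (hT : ∀ i, Supports μ ν (κ i) T) : Supports μ ν (⋂ i, κ i) T := by
  rw [supports_iff_vanishesOn_compl, Set.compl_iInter]
  exact VanishesOn.iUnion hκ fun i => supports_iff_vanishesOn_compl.1 (hT i)

/-- A compact operator supported on `κ` is supported on every member of an m-resolution of `κ` with
operator `U`-set differences, by transfinite induction. -/
theorem IsMResolution.supports {κ : Set (X × Y)} {α : Ordinal.{0}}
    {κs : Ordinal.{0} → Set (X × Y)} (hres : IsMResolution μ ν κ α κs)
    (hU : ∀ β, 1 ≤ β → β < α → ¬ IsOperatorMSet μ ν (κs β \ κs (β + 1)))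
    {T : Lp ℂ 2 μ →L[ℂ] Lp ℂ 2 ν} (hT : IsCompactOperator T) (hTκ : Supports μ ν κ T)
    {β : Ordinal.{0}} (h1 : 1 ≤ β) (hβ : β ≤ α) : Supports μ ν (κs β) T := by
  induction β using Ordinal.limitRecOn with
  | zero => exact absurd h1 (by simp)
  | add_one γ ih =>
    rcases eq_or_ne γ 0 with rfl | hγ
    · rw [zero_add, hres.first]
      exact hTκ
    · have hγ1 : 1 ≤ γ := Order.one_le_iff_ne_zero.2 hγ
      have hγα : γ < α := lt_of_lt_of_le (lt_add_one γ) hβ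
      exact (ih hγ1 hγα.le).of_isMSeparable (hres.isOmegaClosed γ hγ1 hγα.le)
        (hres.separable γ hγ1 hγα) (hU γ hγ1 hγα) hT
  | limit β hlim ih =>
    have hcount : Countable {γ : Ordinal.{0} // 1 ≤ γ ∧ γ < β} := by
      have hIio : (Set.Iio β).Countable := by
        rw [← Cardinal.le_aleph0_iff_set_countable, Cardinal.mk_Iio_ordinal,
          Cardinal.lift_le_aleph0]
        exact (Ordinal.card_le_card hβ).trans hres.countable
      exact (hIio.mono fun γ hγ => hγ.2).to_subtype
    -- The family below is nonempty, as the limit ordinal `β` exceeds `1`.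
    have hone : (1 : Ordinal.{0}) < β := by
      have := hlim.succ_lt (pos_iff_ne_zero.2 (by rintro rfl; simp at h1))
      simpa using this
    have : Nonempty {γ : Ordinal.{0} // 1 ≤ γ ∧ γ < β} := ⟨⟨1, le_rfl, hone⟩⟩
    have heq : κs β = ⋂ γ : {γ : Ordinal.{0} // 1 ≤ γ ∧ γ < β}, κs γ := by
      rw [hres.limit β hlim hβ]
      ext p
      simp only [Set.mem_iInter, Subtype.forall, and_imp]
    rw [heq]
    exact Supports.iInter (κ := fun γ : {γ : Ordinal.{0} // 1 ≤ γ ∧ γ < β} => κs γ)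
      (fun γ => hres.isOmegaClosed γ γ.2.1 (γ.2.2.le.trans hβ))
      fun γ => ih γ γ.2.2 γ.2.1 (γ.2.2.le.trans hβ)

end Resolution

end

theorem mainTheorem11
    {X Y : Type*}
    [TopologicalSpace X] [TopologicalSpace.IsCompletelyMetrizableSpace X]
    [MeasurableSpace X] [BorelSpace X]
    [TopologicalSpace Y] [TopologicalSpace.IsCompletelyMetrizableSpace Y]
    [MeasurableSpace Y] [BorelSpace Y]
    (μ : Measure X) [μ.Regular] [SigmaFinite μ]
    (ν : Measure Y) [ν.Regular] [SigmaFinite ν]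
    (κ : Set (X × Y)) (hκ : IsOmegaClosed μ ν κ)
    (α : Ordinal.{0}) (κs : Ordinal.{0} → Set (X × Y))
    (hres : IsMResolution μ ν κ α κs)
    (hdiff : ∀ β, 1 ≤ β → β < α → IsOperatorUSet μ ν (κs β \ κs (β + 1)))
    (hlast : IsOperatorUSet μ ν (κs α)) :
    IsOperatorUSet μ ν κ := by
  refine ⟨hκ, ?_⟩
  rintro ⟨T, hTκ, hT, hne⟩
  exact hlast.2 ⟨T, hres.supports (fun β h1 hβ => (hdiff β h1 hβ).2) hT hTκ hres.one_le le_rfl,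
    hT, hne⟩
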